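/- Let $r\le s\le t$ be natural numbers such that the complete tripartite graph $K_{r,s,t}$ (with parts of sizes $r,s,t$) decomposes into $5$-cycles, i.e. its edge set can be partitioned into edge sets of cycles of length $5$. Let $p$ be a multiple of $5$ with $p\equiv r \pmod 2$ and $\frac t2\le p\le 3r$. Then $K_{r+2p,\,s+2p,\,t+2p}$ decomposes into $5$-cycles. More generally, $K_{r+np,\,s+np,\,t+np}$ decomposes into $5$-cycles for every natural number $n$. -/

import Mathlib

/-- The complete tripartite graph `K_{r,s,t}`, whose parts have `r`, `s` and `t` vertices. -/
abbrev completeTripartite (r s t : ℕ) :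
    SimpleGraph (Σ i : Fin 3, Fin (![r, s, t] i)) :=
  SimpleGraph.completeMultipartiteGraph (fun i : Fin 3 => Fin (![r, s, t] i))

/-- `D` is a decomposition of `G` into 5-cycles: every member of `D` is a subgraph of `G` which is
a cycle of length five, and every edge of `G` lies in exactly one member of `D`. -/
def IsFiveCycleDecomposition {V : Type*} (G : SimpleGraph V) (D : Set G.Subgraph) : Prop :=
  (∀ H ∈ D, Nonempty (H.coe ≃g SimpleGraph.cycleGraph 5)) ∧
    ∀ e ∈ G.edgeSet, ∃! H : G.Subgraph, H ∈ D ∧ e ∈ H.edgeSet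

/-- `G` can be decomposed into 5-cycles. -/
def FiveCycleDecomposable {V : Type*} (G : SimpleGraph V) : Prop :=
  ∃ D : Set G.Subgraph, IsFiveCycleDecomposition G D

/-! Write p = 5q and split each part into n + 1 blocks, one of the original size and n of size p.
The triples of blocks with index sum 0 in `ZMod (n + 1)` form a Latin square, so every edge lies in
exactly one triple (`hasFamily_of_latin_square`). The zero triple gives the original graph; any
other has at least two blocks of size p, and its third has size x, one of r, s, t, p. Even degrees
and the bounds on p give x ≡ p mod 2 and p ≤ 3x ≤ 6p, so it remains to decompose K_{x,p,p}.

That graph is a lift, with group `ZMod q`, of a multigraph with parts x, 5, 5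
(`BaseDecomposable.hasFamily_liftGraph`). Decompositions of such multigraphs add in (x, q), and a
few small ones found explicitly generate every admissible pair (`baseDecomposable_of_le`). -/

open Function

/-! ### Decompositions as families of closed walks -/

/-- `G` can be decomposed into 5-cycles, given as an indexed family of injective closed walks. -/
def HasFiveCycleFamily {V : Type} (G : SimpleGraph V) : Prop :=
  ∃ (I : Type) (f : I → Fin 5 → V), (∀ i, Injective (f i)) ∧
    (∀ i k, G.Adj (f i k) (f i (k + 1))) ∧
    ∀ e ∈ G.edgeSet, ∃! x : I × Fin 5, s(f x.1 x.2, f x.1 (x.2 + 1)) = e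

theorem cycleGraph_five_adj_iff (a b : Fin 5) :
    (SimpleGraph.cycleGraph 5).Adj a b ↔ ∃ k : Fin 5, s(k, k + 1) = s(a, b) := by
  revert a b; decide

theorem fin_five_edge_injective : Injective fun k : Fin 5 => s(k, k + 1) := by
  decide

/-- The subgraph traced by a closed walk of length five. -/
def fiveCycleSubgraph {V : Type} (G : SimpleGraph V) (f : Fin 5 → V)
    (hadj : ∀ k, G.Adj (f k) (f (k + 1))) : G.Subgraph where
  verts := Set.range f
  Adj u v := ∃ k, s(f k, f (k + 1)) = s(u, v)
  adj_sub := by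
    rintro u v ⟨k, hk⟩
    rw [← SimpleGraph.mem_edgeSet, ← hk]
    exact hadj k
  edge_vert := by
    rintro u v ⟨k, hk⟩
    have : u ∈ s(f k, f (k + 1)) := hk ▸ Sym2.mem_mk_left u v
    rcases Sym2.mem_iff.1 this with h | h <;> exact h ▸ ⟨_, rfl⟩
  symm := ⟨by
    rintro u v ⟨k, hk⟩
    exact ⟨k, hk.trans Sym2.eq_swap⟩⟩

theorem nonempty_iso_cycleGraph_of_injective {V : Type} (G : SimpleGraph V) (f : Fin 5 → V)
    (hadj : ∀ k, G.Adj (f k) (f (k + 1))) (hf : Injective f) :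
    Nonempty ((fiveCycleSubgraph G f hadj).coe ≃g SimpleGraph.cycleGraph 5) := by
  refine ⟨SimpleGraph.Iso.symm ⟨Equiv.ofInjective f hf, ?_⟩⟩
  intro a b
  rw [cycleGraph_five_adj_iff]
  change (∃ k, s(f k, f (k + 1)) = s(f a, f b)) ↔ _
  refine exists_congr fun k => ?_
  rw [← Sym2.map_mk, ← Sym2.map_mk]
  exact (Sym2.map.injective hf).eq_iff

theorem HasFiveCycleFamily.decomposable {V : Type} {G : SimpleGraph V}
    (h : HasFiveCycleFamily G) : FiveCycleDecomposable G := by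
  obtain ⟨I, f, hinj, hadj, huniq⟩ := h
  refine ⟨Set.range fun i => fiveCycleSubgraph G (f i) (hadj i), ?_, ?_⟩
  · rintro _ ⟨i, rfl⟩
    exact nonempty_iso_cycleGraph_of_injective G _ _ (hinj i)
  · intro e he
    have key : ∀ i, e ∈ (fiveCycleSubgraph G (f i) (hadj i)).edgeSet ↔
        ∃ k, s(f i k, f i (k + 1)) = e := by
      intro i
      induction e using Sym2.ind
      rfl
    obtain ⟨⟨i, k⟩, hik, hu⟩ := huniq e he
    refine ⟨_, ⟨⟨i, rfl⟩, (key i).2 ⟨k, hik⟩⟩, ?_⟩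
    rintro _ ⟨⟨j, rfl⟩, hj⟩
    obtain ⟨l, hl⟩ := (key j).1 hj
    have := hu (j, l) hl
    simp only [Prod.mk.injEq] at this
    rw [this.1]

theorem FiveCycleDecomposable.hasFamily {V : Type} {G : SimpleGraph V}
    (h : FiveCycleDecomposable G) : HasFiveCycleFamily G := by
  obtain ⟨D, hD, huniq⟩ := h
  have φ : ∀ H : D, H.1.coe ≃g SimpleGraph.cycleGraph 5 := fun H => (hD H.1 H.2).some
  have inj : ∀ H : D, Injective fun k => ((φ H).symm k : V) := fun H =>
    Subtype.val_injective.comp (φ H).symm.injective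
  have hadj : ∀ (H : D) k, H.1.Adj ((φ H).symm k : V) ((φ H).symm (k + 1) : V) := by
    intro H k
    have : (SimpleGraph.cycleGraph 5).Adj k (k + 1) :=
      (cycleGraph_five_adj_iff _ _).2 ⟨k, rfl⟩
    exact (φ H).symm.map_adj_iff.2 this
  refine ⟨D, fun H k => (φ H).symm k, inj, fun H k => (hadj H k).adj_sub, ?_⟩
  intro e he
  obtain ⟨H, ⟨hHD, heH⟩, hu⟩ := huniq e he
  have ex : ∃ k, s(((φ ⟨H, hHD⟩).symm k : V), ((φ ⟨H, hHD⟩).symm (k + 1) : V)) = e := by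
    induction e using Sym2.ind with
    | _ u v =>
    have huv : H.Adj u v := heH
    have : (SimpleGraph.cycleGraph 5).Adj (φ ⟨H, hHD⟩ ⟨u, huv.fst_mem⟩)
        (φ ⟨H, hHD⟩ ⟨v, huv.snd_mem⟩) := (φ ⟨H, hHD⟩).map_adj_iff.2 huv
    obtain ⟨k, hk⟩ := (cycleGraph_five_adj_iff _ _).1 this
    refine ⟨k, ?_⟩
    have := congrArg (Sym2.map fun k => ((φ ⟨H, hHD⟩).symm k : V)) hk
    simpa using this
  obtain ⟨k, hk⟩ := ex
  refine ⟨(⟨H, hHD⟩, k), hk, ?_⟩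
  rintro ⟨H', l⟩ hl
  have : H'.1 = H := by
    refine hu _ ⟨H'.2, ?_⟩
    rw [← hl]
    exact hadj H' l
  obtain rfl : H' = ⟨H, hHD⟩ := Subtype.ext this
  have := hk.trans hl.symm
  rw [← Sym2.map_mk (fun k => ((φ ⟨H, hHD⟩).symm k : V)),
    ← Sym2.map_mk (fun k => ((φ ⟨H, hHD⟩).symm k : V))] at this
  rw [fin_five_edge_injective (Sym2.map.injective (inj _) this)]

/-- An edge-disjoint union of copies of graphs that decompose into 5-cycles does so as well. -/
theorem HasFiveCycleFamily.of_embeddings {J : Type} {V : J → Type} {W : Type}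
    {G : ∀ j, SimpleGraph (V j)} {H : SimpleGraph W} (φ : ∀ j, G j →g H)
    (hφ : ∀ j, Injective (φ j)) (hG : ∀ j, HasFiveCycleFamily (G j))
    (h : ∀ e ∈ H.edgeSet, ∃! j, ∃ e' ∈ (G j).edgeSet, e'.map (φ j) = e) :
    HasFiveCycleFamily H := by
  choose I f hinj hadj huniq using hG
  refine ⟨Σ j, I j, fun x k => φ x.1 (f x.1 x.2 k), fun x => (hφ _).comp (hinj _ _),
    fun x k => (φ x.1).map_adj (hadj _ _ _), ?_⟩
  intro e he
  obtain ⟨j, ⟨e', he', rfl⟩, hj⟩ := h e he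
  obtain ⟨⟨i, k⟩, hik, hu⟩ := huniq j e' he'
  refine ⟨(⟨j, i⟩, k), congrArg (Sym2.map (φ j)) hik, ?_⟩
  rintro ⟨⟨j', i'⟩, k'⟩ h'
  obtain rfl : j' = j := hj j' ⟨s(f j' i' k', f j' i' (k' + 1)), hadj j' i' k', h'⟩
  have := hu (i', k') (Sym2.map.injective (hφ _) h')
  simp only [Prod.mk.injEq] at this
  obtain ⟨rfl, rfl⟩ := this
  rfl

theorem HasFiveCycleFamily.of_iso {V W : Type} {G : SimpleGraph V} {H : SimpleGraph W}
    (h : HasFiveCycleFamily G) (φ : G ≃g H) : HasFiveCycleFamily H := by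
  refine .of_embeddings (J := Unit) (fun _ => φ.toHom) (fun _ => φ.injective) (fun _ => h) ?_
  intro e he
  refine ⟨(), ⟨e.map φ.symm, ?_, ?_⟩, fun _ _ => rfl⟩
  · induction e using Sym2.ind with
    | _ u v => exact φ.symm.map_adj_iff.2 he
  · induction e using Sym2.ind with
    | _ u v => simp

/-- All degrees of a graph that decomposes into 5-cycles are even. -/
theorem HasFiveCycleFamily.even_card_neighborSet {V : Type} {G : SimpleGraph V}
    (h : HasFiveCycleFamily G) (v : V) [Finite (G.neighborSet v)] :
    Even (Nat.card (G.neighborSet v)) := by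
  obtain ⟨I, f, hinj, hadj, huniq⟩ := h
  -- `S` is the set of visits of the cycles to `v`. Each visit uses one edge to the successor and
  -- one to the predecessor, so two copies of `S` biject with the neighbours.
  let S := {x : I × Fin 5 // f x.1 x.2 = v}
  let F : S ⊕ S → G.neighborSet v := Sum.elim
    (fun x => ⟨f x.1.1 (x.1.2 + 1), by have := hadj x.1.1 x.1.2; rwa [x.2] at this⟩)
    (fun x => ⟨f x.1.1 (x.1.2 - 1), by
      have := (hadj x.1.1 (x.1.2 - 1)).symm
      rwa [sub_add_cancel, x.2] at this⟩)
  have hF : Bijective F := by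
    constructor
    · have eqs : ∀ x y : I × Fin 5, s(f x.1 x.2, f x.1 (x.2 + 1)) = s(f y.1 y.2, f y.1 (y.2 + 1)) →
          x = y := fun x y hxy => (huniq _ (hadj y.1 y.2)).unique hxy rfl
      rintro (⟨⟨i, k⟩, hx⟩ | ⟨⟨i, k⟩, hx⟩) (⟨⟨j, l⟩, hy⟩ | ⟨⟨j, l⟩, hy⟩) hxy
      · have h1 : f i (k + 1) = f j (l + 1) := congrArg Subtype.val hxy
        have := eqs (i, k) (j, l) (by simp only at hx hy ⊢; rw [h1, hx, hy])
        simp only [this]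
      · have h1 : f i (k + 1) = f j (l - 1) := congrArg Subtype.val hxy
        have := eqs (i, k) (j, l - 1) (by
          simp only [sub_add_cancel] at hx hy ⊢; rw [h1, hx, hy, Sym2.eq_swap])
        simp only [Prod.mk.injEq] at this
        obtain ⟨rfl, rfl⟩ := this
        exact absurd (hinj _ (hx.trans hy.symm)) (by simp)
      · have h1 : f i (k - 1) = f j (l + 1) := congrArg Subtype.val hxy
        have := eqs (i, k - 1) (j, l) (by
          simp only [sub_add_cancel] at hx hy ⊢; rw [h1, hx, hy, Sym2.eq_swap])
        simp only [Prod.mk.injEq] at this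
        obtain ⟨rfl, rfl⟩ := this
        exact absurd (hinj _ (hx.trans hy.symm)) (by simp [eq_sub_iff_add_eq])
      · have h1 : f i (k - 1) = f j (l - 1) := congrArg Subtype.val hxy
        have := eqs (i, k - 1) (j, l - 1) (by
          simp only [sub_add_cancel] at hx hy ⊢; rw [h1, hx, hy])
        simp only [Prod.mk.injEq, sub_left_inj] at this
        obtain ⟨rfl, rfl⟩ := this
        rfl
    · rintro ⟨w, hw⟩
      obtain ⟨⟨i, k⟩, hik, -⟩ := huniq s(v, w) hw
      rcases Sym2.eq_iff.1 hik with ⟨h1, h2⟩ | ⟨h1, h2⟩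
      · exact ⟨.inl ⟨(i, k), h1⟩, Subtype.ext h2⟩
      · exact ⟨.inr ⟨(i, k + 1), h2⟩, Subtype.ext (by simpa [F] using h1)⟩
  have fin : Finite (S ⊕ S) := Finite.of_injective F hF.1
  have : Finite S := Finite.of_injective (Sum.inl : S → S ⊕ S) Sum.inl_injective
  rw [← Nat.card_congr (Equiv.ofBijective F hF), Nat.card_sum]
  exact ⟨_, rfl⟩

/-! ### Base multigraphs and their decompositions -/

/-- A 5-cycle in the multigraph with parts `A`, `Fin 5`, `Fin 5` in which vertices of the last two
parts are joined by one edge for each label in `L` and all other pairs of vertices in different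
parts by a single edge. -/
inductive BaseCycle (A L : Type) : Type
  | y (a : A) (u : Fin 5 ⊕ Fin 5) (a' : A) (b c : Fin 5) (d : L)
  | z (a : A) (b c b' c' : Fin 5) (d₁ d₂ d₃ : L)

abbrev BaseEdge (A L : Type) : Type := (A × (Fin 5 ⊕ Fin 5)) ⊕ (Fin 5 × Fin 5 × L)

namespace BaseCycle

variable {A A' L L' : Type}

def edges : BaseCycle A L → Fin 5 → BaseEdge A L
  | y a u a' b c d => ![.inl (a, u), .inl (a', u), .inl (a', .inl b), .inr (b, c, d),
      .inl (a, .inr c)]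
  | z a b c b' c' d₁ d₂ d₃ => ![.inl (a, .inl b), .inr (b, c, d₁), .inr (b', c, d₂),
      .inr (b', c', d₃), .inl (a, .inr c')]

/-- The vertices of the cycle are distinct. -/
def Proper : BaseCycle A L → Prop
  | y a u a' b c _ => a ≠ a' ∧ u ≠ .inl b ∧ u ≠ .inr c
  | z _ b c b' c' _ _ _ => b ≠ b' ∧ c ≠ c'

instance [DecidableEq A] : DecidablePred (Proper : BaseCycle A L → Prop)
  | y _ _ _ _ _ _ => inferInstanceAs (Decidable (_ ∧ _))
  | z _ _ _ _ _ _ _ _ => inferInstanceAs (Decidable (_ ∧ _))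

def map (f : A → A') (g : L → L') : BaseCycle A L → BaseCycle A' L'
  | y a u a' b c d => y (f a) u (f a') b c (g d)
  | z a b c b' c' d₁ d₂ d₃ => z (f a) b c b' c' (g d₁) (g d₂) (g d₃)

theorem Proper.map {C : BaseCycle A L} (h : C.Proper) {f : A → A'} (hf : Injective f)
    (g : L → L') : (C.map f g).Proper := by
  cases C
  · exact ⟨hf.ne h.1, h.2⟩
  · exact h

def mapEdge (f : A → A') (g : L → L') : BaseEdge A L → BaseEdge A' L' :=
  Sum.map (Prod.map f id) (Prod.map id (Prod.map id g))

theorem edges_map (f : A → A') (g : L → L') (C : BaseCycle A L) (k : Fin 5) :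
    (C.map f g).edges k = mapEdge f g (C.edges k) := by
  cases C <;> fin_cases k <;> rfl

end BaseCycle

/-- The labels form a bare set, with no condition on their sum along a cycle: every cycle passes
through `A`, whose vertices translation will fix, so its lift closes up whatever the labels are. -/
def BaseDecomposable (A L : Type) : Prop :=
  ∃ (T : Type) (f : T → BaseCycle A L), (∀ t, (f t).Proper) ∧
    Bijective fun x : T × Fin 5 => (f x.1).edges x.2

open BaseCycle in
theorem BaseDecomposable.congr {A A' L L' : Type} (h : BaseDecomposable A L) (e : A ≃ A')
    (e' : L ≃ L') : BaseDecomposable A' L' := by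
  obtain ⟨T, f, hf, hb⟩ := h
  refine ⟨T, fun t => (f t).map e e', fun t => (hf t).map e.injective _, ?_⟩
  simp only [edges_map]
  have : Bijective (mapEdge e e') :=
    (Equiv.sumCongr (Equiv.prodCongr e (Equiv.refl _))
      (Equiv.prodCongr (Equiv.refl _) (Equiv.prodCongr (Equiv.refl _) e'))).bijective
  exact this.comp hb

open BaseCycle in
-- An edge carries either a vertex of `A` or a label, never both, so the edge set for the sums is
-- the disjoint union of the two edge sets.
theorem BaseDecomposable.sum {A A' L L' : Type} (h : BaseDecomposable A L)
    (h' : BaseDecomposable A' L') : BaseDecomposable (A ⊕ A') (L ⊕ L') := by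
  obtain ⟨T, f, hf, hb⟩ := h
  obtain ⟨T', f', hf', hb'⟩ := h'
  have i1 : Injective (mapEdge (Sum.inl : A → A ⊕ A') (Sum.inl : L → L ⊕ L')) :=
    Sum.map_injective.2 ⟨Sum.inl_injective.prodMap injective_id,
      injective_id.prodMap (injective_id.prodMap Sum.inl_injective)⟩
  have i2 : Injective (mapEdge (Sum.inr : A' → A ⊕ A') (Sum.inr : L' → L ⊕ L')) :=
    Sum.map_injective.2 ⟨Sum.inr_injective.prodMap injective_id,
      injective_id.prodMap (injective_id.prodMap Sum.inr_injective)⟩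
  have ne : ∀ (e : BaseEdge A L) (e' : BaseEdge A' L'),
      mapEdge (Sum.inl : A → A ⊕ A') (Sum.inl : L → L ⊕ L') e ≠ mapEdge Sum.inr Sum.inr e' := by
    rintro (⟨a, u⟩ | ⟨b, c, d⟩) (⟨a', u'⟩ | ⟨b', c', d'⟩) <;> simp [mapEdge]
  refine ⟨T ⊕ T', Sum.elim (fun t => (f t).map .inl .inl) (fun t => (f' t).map .inr .inr),
    ?_, ?_, ?_⟩
  · rintro (t | t)
    exacts [(hf t).map Sum.inl_injective _, (hf' t).map Sum.inr_injective _]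
  · rintro ⟨t | t, k⟩ ⟨t' | t', k'⟩ h <;>
      simp only [Sum.elim_inl, Sum.elim_inr, edges_map] at h
    · have := @hb.1 (t, k) (t', k') (i1 h)
      simp only [Prod.mk.injEq] at this
      rw [this.1, this.2]
    · exact absurd h (ne _ _)
    · exact absurd h.symm (ne _ _)
    · have := @hb'.1 (t, k) (t', k') (i2 h)
      simp only [Prod.mk.injEq] at this
      rw [this.1, this.2]
  · have s1 : ∀ e, ∃ x : (T ⊕ T') × Fin 5, (Sum.elim (fun t => (f t).map .inl .inl)
        (fun t => (f' t).map .inr .inr) x.1).edges x.2 =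
        mapEdge (Sum.inl : A → A ⊕ A') (Sum.inl : L → L ⊕ L') e := by
      intro e
      obtain ⟨⟨t, k⟩, rfl⟩ := hb.2 e
      exact ⟨(.inl t, k), edges_map _ _ _ _⟩
    have s2 : ∀ e, ∃ x : (T ⊕ T') × Fin 5, (Sum.elim (fun t => (f t).map .inl .inl)
        (fun t => (f' t).map .inr .inr) x.1).edges x.2 =
        mapEdge (Sum.inr : A' → A ⊕ A') (Sum.inr : L' → L ⊕ L') e := by
      intro e
      obtain ⟨⟨t, k⟩, rfl⟩ := hb'.2 e
      exact ⟨(.inr t, k), edges_map _ _ _ _⟩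
    rintro (⟨a | a, u⟩ | ⟨b, c, d | d⟩)
    exacts [s1 (.inl (a, u)), s2 (.inl (a, u)), s1 (.inr (b, c, d)), s2 (.inr (b, c, d))]

/-- Distinct edges in the right number exhaust a finite edge set, which leaves only computable
checks. -/
theorem BaseDecomposable.of_list {A L : Type} [Fintype A] [Fintype L] [DecidableEq A]
    [DecidableEq L] (l : List (BaseCycle A L)) (hl : ∀ C ∈ l, C.Proper)
    (hnd : (l.flatMap fun C => List.ofFn C.edges).Nodup)
    (hc : 5 * l.length = Fintype.card (BaseEdge A L)) : BaseDecomposable A L := by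
  refine ⟨{C // C ∈ l}, Subtype.val, fun C => hl C.1 C.2, ?_, ?_⟩
  · rw [List.nodup_flatMap] at hnd
    rintro ⟨⟨C, hC⟩, k⟩ ⟨⟨C', hC'⟩, k'⟩ h
    simp only at h
    have hCC : C = C' := by
      by_contra hne
      have : Std.Symm (List.Disjoint on fun C : BaseCycle A L => List.ofFn C.edges) :=
        ⟨fun _ _ h => List.Disjoint.symm h⟩
      exact hnd.2.forall hC hC' hne (List.mem_ofFn.2 ⟨k, rfl⟩)
        (List.mem_ofFn.2 ⟨k', h.symm⟩)
    subst hCC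
    rw [List.nodup_ofFn.1 (hnd.1 C hC) h]
  · intro e
    have : (l.flatMap fun C => List.ofFn C.edges).toFinset = Finset.univ := by
      refine Finset.eq_univ_of_card _ ?_
      rw [List.toFinset_card_of_nodup hnd, ← hc]
      simp [mul_comm]
    have he : e ∈ (l.flatMap fun C => List.ofFn C.edges) := by
      rw [← List.mem_toFinset, this]
      exact Finset.mem_univ _
    obtain ⟨C, hC, heC⟩ := List.mem_flatMap.1 he
    obtain ⟨k, rfl⟩ := List.mem_ofFn.1 heC
    exact ⟨(⟨C, hC⟩, k), rfl⟩

/-- `BaseDecomposable` for `x` vertices in the first part and `q` labels. -/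
abbrev BaseDecomposableFin (x q : ℕ) : Prop := BaseDecomposable (Fin x) (Fin q)

/-! ### Explicit small decompositions -/

theorem baseDecomposable_three_one : BaseDecomposableFin 3 1 :=
  .of_list
    [.y 1 (.inl 3) 2 0 0 0, .z 0 1 0 3 3 0 0 0, .z 0 3 4 2 2 0 0 0, .z 1 1 2 3 1 0 0 0,
     .z 0 2 1 1 4 0 0 0, .y 1 (.inl 2) 2 1 3 0, .z 0 0 3 2 0 0 0 0, .y 2 (.inr 2) 1 4 0 0,
     .y 2 (.inr 1) 0 4 3 0, .z 1 0 2 4 4 0 0 0, .z 2 4 1 0 4 0 0 0]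
    (by decide +kernel) (by decide +kernel) (by decide +kernel)

theorem baseDecomposable_five_one : BaseDecomposableFin 5 1 :=
  .of_list
    -- Three cycles developed modulo 5, all coordinates but the label advancing together.
    [.y 2 (.inl 3) 0 0 1 0, .y 3 (.inl 4) 1 1 2 0, .y 4 (.inl 0) 2 2 3 0, .y 0 (.inl 1) 3 3 4 0,
     .y 1 (.inl 2) 4 4 0 0, .y 0 (.inr 1) 1 0 2 0, .y 1 (.inr 2) 2 1 3 0, .y 2 (.inr 3) 3 2 4 0,
     .y 3 (.inr 4) 4 3 0 0, .y 4 (.inr 0) 0 4 1 0, .z 3 0 0 2 1 0 0 0, .z 4 1 1 3 2 0 0 0,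
     .z 0 2 2 4 3 0 0 0, .z 1 3 3 0 4 0 0 0, .z 2 4 4 1 0 0 0 0]
    (by decide +kernel) (by decide +kernel) (by decide +kernel)

theorem baseDecomposable_seven_one : BaseDecomposableFin 7 1 :=
  .of_list
    [.y 0 (.inl 0) 6 1 0 0, .y 6 (.inr 1) 4 0 0 0, .z 4 2 1 3 0 0 0 0, .y 4 (.inl 3) 6 2 2 0,
     .y 6 (.inl 4) 3 1 2 0, .y 6 (.inr 4) 4 1 3 0, .z 4 4 4 0 3 0 0 0, .y 1 (.inr 0) 3 0 2 0,
     .y 5 (.inl 0) 1 1 4 0, .y 3 (.inl 3) 2 0 1 0, .y 3 (.inr 4) 0 2 3 0, .y 3 (.inl 2) 5 3 2 0,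
     .z 2 4 0 2 4 0 0 0, .y 1 (.inr 3) 0 3 4 0, .y 2 (.inl 2) 1 4 1 0, .y 5 (.inr 1) 1 3 3 0,
     .y 2 (.inr 0) 5 4 2 0, .y 2 (.inl 1) 0 4 3 0, .y 0 (.inr 2) 5 1 1 0]
    (by decide +kernel) (by decide +kernel) (by decide +kernel)

theorem baseDecomposable_nine_one : BaseDecomposableFin 9 1 :=
  .of_list
    [.y 7 (.inr 2) 0 0 3 0, .y 8 (.inr 0) 7 0 4 0, .y 5 (.inr 4) 7 2 3 0, .y 6 (.inr 1) 7 1 4 0,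
     .y 3 (.inl 3) 7 4 3 0, .y 8 (.inr 3) 0 4 2 0, .y 2 (.inr 3) 6 3 2 0, .z 6 1 3 3 0 0 0 0,
     .y 4 (.inr 3) 1 2 4 0, .y 6 (.inl 0) 3 2 2 0, .y 4 (.inl 2) 6 4 0 0, .y 2 (.inl 3) 0 2 1 0,
     .y 5 (.inl 2) 2 1 0 0, .y 0 (.inl 1) 8 2 0 0, .y 0 (.inr 4) 1 1 1 0, .y 2 (.inl 4) 8 0 0 0,
     .y 8 (.inl 3) 4 0 1 0, .y 2 (.inl 0) 1 3 4 0, .y 3 (.inr 0) 1 4 4 0, .y 3 (.inl 4) 5 0 2 0,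
     .y 1 (.inr 2) 4 4 1 0, .y 5 (.inr 1) 3 1 2 0, .y 4 (.inl 1) 5 3 1 0]
    (by decide +kernel) (by decide +kernel) (by decide +kernel)

theorem baseDecomposable_four_two : BaseDecomposableFin 4 2 :=
  .of_list
    [.z 1 2 1 0 0 1 1 0, .z 3 1 0 2 2 0 0 0, .z 2 3 0 2 3 1 1 0, .z 2 2 4 0 1 0 1 0,
     .z 0 2 1 1 2 0 0 1, .z 1 3 2 2 3 0 1 1, .z 3 2 4 4 1 1 1 1, .z 0 1 4 3 1 0 0 0,
     .z 3 3 1 1 0 1 1 1, .z 1 1 3 4 1 1 0 0, .y 1 (.inl 4) 2 1 2 0, .z 3 4 4 1 3 0 1 0,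
     .z 1 0 3 3 4 0 0 1, .y 2 (.inr 4) 3 0 0 1, .z 2 0 3 4 2 1 1 0, .z 0 3 2 0 4 1 1 0,
     .z 0 0 2 4 0 0 1 0, .z 0 4 0 3 3 1 0 1]
    (by decide +kernel) (by decide +kernel) (by decide +kernel)

theorem baseDecomposable_twenty_two : BaseDecomposableFin 20 2 :=
  .of_list
    -- Ten orbits modulo 5; the 20 vertices rotate within four blocks of five.
    [.y 4 (.inl 4) 15 0 0 1, .y 0 (.inl 0) 16 1 1 1, .y 1 (.inl 1) 17 2 2 1,
     .y 2 (.inl 2) 18 3 3 1, .y 3 (.inl 3) 19 4 4 1, .y 12 (.inr 3) 4 0 1 0,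
     .y 13 (.inr 4) 0 1 2 0, .y 14 (.inr 0) 1 2 3 0, .y 10 (.inr 1) 2 3 4 0,
     .y 11 (.inr 2) 3 4 0 0, .y 4 (.inl 2) 19 0 1 1, .y 0 (.inl 3) 15 1 2 1,
     .y 1 (.inl 4) 16 2 3 1, .y 2 (.inl 0) 17 3 4 1, .y 3 (.inl 1) 18 4 0 1,
     .y 12 (.inr 4) 1 0 2 0, .y 13 (.inr 0) 2 1 3 0, .y 14 (.inr 1) 3 2 4 0,
     .y 10 (.inr 2) 4 3 0 0, .y 11 (.inr 3) 0 4 1 0, .y 4 (.inl 1) 12 0 4 0,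
     .y 0 (.inl 2) 13 1 0 0, .y 1 (.inl 3) 14 2 1 0, .y 2 (.inl 4) 10 3 2 0,
     .y 3 (.inl 0) 11 4 3 0, .y 7 (.inl 1) 10 0 0 0, .y 8 (.inl 2) 11 1 1 0,
     .y 9 (.inl 3) 12 2 2 0, .y 5 (.inl 4) 13 3 3 0, .y 6 (.inl 0) 14 4 4 0,
     .y 14 (.inl 1) 8 0 2 1, .y 10 (.inl 2) 9 1 3 1, .y 11 (.inl 3) 5 2 4 1,
     .y 12 (.inl 4) 6 3 0 1, .y 13 (.inl 0) 7 4 1 1, .y 18 (.inr 4) 5 0 3 0,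
     .y 19 (.inr 0) 6 1 4 0, .y 15 (.inr 1) 7 2 0 0, .y 16 (.inr 2) 8 3 1 0,
     .y 17 (.inr 3) 9 4 2 0, .y 16 (.inr 0) 9 0 4 1, .y 17 (.inr 1) 5 1 0 1,
     .y 18 (.inr 2) 6 2 1 1, .y 19 (.inr 3) 7 3 2 1, .y 15 (.inr 4) 8 4 3 1,
     .y 8 (.inr 0) 18 0 3 1, .y 9 (.inr 1) 19 1 4 1, .y 5 (.inr 2) 15 2 0 1,
     .y 6 (.inr 3) 16 3 1 1, .y 7 (.inr 4) 17 4 2 1]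
    (by decide +kernel) (by decide +kernel) (by decide +kernel)

theorem baseDecomposable_five_three : BaseDecomposableFin 5 3 :=
  .of_list
    [.z 2 0 0 4 3 0 1 2, .z 3 1 1 0 4 0 1 2, .z 4 2 2 1 0 0 1 2, .z 0 3 3 2 1 0 1 2,
     .z 1 4 4 3 2 0 1 2, .z 0 0 2 4 4 2 0 1, .z 1 1 3 0 0 2 0 1, .z 2 2 4 1 1 2 0 1,
     .z 3 3 0 2 2 2 0 1, .z 4 4 1 3 3 2 0 1, .z 1 0 1 3 4 0 1 2, .z 2 1 2 4 0 0 1 2,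
     .z 3 2 3 0 1 0 1 2, .z 4 3 4 1 2 0 1 2, .z 0 4 0 2 3 0 1 2, .z 3 0 2 4 3 1 2 0,
     .z 4 1 3 0 4 1 2 0, .z 0 2 4 1 0 1 2 0, .z 1 3 0 2 1 1 2 0, .z 2 4 1 3 2 1 2 0,
     .z 4 0 2 2 1 0 2 1, .z 0 1 3 3 2 0 2 1, .z 1 2 4 4 3 0 2 1, .z 2 3 0 0 4 0 2 1,
     .z 3 4 1 1 0 0 2 1]
    (by decide +kernel) (by decide +kernel) (by decide +kernel)

theorem baseDecomposable_seven_three : BaseDecomposableFin 7 3 :=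
  .of_list
    [.z 3 4 0 0 3 1 0 0, .y 2 (.inl 0) 3 2 3 0, .z 3 3 1 2 0 0 2 2, .y 3 (.inr 4) 4 0 1 0,
     .z 3 1 3 3 2 0 2 1, .z 5 1 3 0 4 1 1 2, .y 5 (.inr 3) 6 1 1 1, .z 5 0 0 2 2 1 0 1,
     .y 2 (.inl 4) 5 3 1 1, .z 5 2 4 3 0 0 0 1, .y 2 (.inr 0) 4 2 4 2, .y 1 (.inl 2) 2 1 1 2,
     .z 2 3 3 2 2 0 1 2, .z 6 4 1 2 4 1 0 1, .z 0 2 1 0 0 1 1 2, .z 1 1 2 2 0 2 0 1,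
     .z 6 2 3 4 2 2 0 0, .z 4 4 0 1 2 0 0 1, .z 4 3 0 4 1 0 2 0, .z 6 0 4 1 0 0 1 1,
     .z 0 1 0 3 4 2 2 1, .z 6 3 2 1 1 0 0 0, .z 4 1 4 4 3 0 1 2, .z 1 4 4 1 3 2 2 2,
     .z 0 0 2 3 3 0 2 1, .z 1 0 3 4 2 2 1 2, .z 1 3 1 4 4 2 2 0, .z 0 4 2 0 1 1 1 2,
     .z 0 3 4 0 2 2 1 2]
    (by decide +kernel) (by decide +kernel) (by decide +kernel)

/-! ### Generating all admissible pairs -/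

theorem BaseDecomposable.add {x q x' q' : ℕ} (h : BaseDecomposableFin x q)
    (h' : BaseDecomposableFin x' q') : BaseDecomposableFin (x + x') (q + q') :=
  (h.sum h').congr finSumFinEquiv finSumFinEquiv

theorem baseDecomposable_zero : BaseDecomposableFin 0 0 :=
  .of_list [] (by simp) (by simp) rfl

/-- Counting the 10x edges at `A` and the 25q labelled edges forces Y = 3x - 5q cycles of type `y`
and Z = 10q - x of type `z`; the bounds say that both are nonnegative. -/
theorem baseDecomposable_of_le (q : ℕ) : ∀ x, 5 * q ≤ 3 * x → x ≤ 10 * q → x % 2 = q % 2 →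
    BaseDecomposableFin x q := by
  induction q using Nat.strong_induction_on with
  | _ q ih =>
  intro x h1 h2 h3
  rcases Nat.eq_zero_or_pos q with rfl | hq
  · obtain rfl : x = 0 := by omega
    exact baseDecomposable_zero
  have step : ∀ {x₀ q₀ : ℕ}, BaseDecomposableFin x₀ q₀ → 0 < q₀ → q₀ ≤ q → x₀ ≤ x →
      5 * (q - q₀) ≤ 3 * (x - x₀) → x - x₀ ≤ 10 * (q - q₀) → (x - x₀) % 2 = (q - q₀) % 2 →
      BaseDecomposableFin x q := by
    intro x₀ q₀ h hq₀ hqq hxx a b c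
    have := h.add (ih (q - q₀) (by omega) (x - x₀) a b c)
    rwa [Nat.add_sub_of_le hqq, Nat.add_sub_of_le hxx] at this
  -- In coordinates (Y, Z) the pairs subtracted below are (50, 0), (0, 25), (22, 1), (16, 3), (10,
  -- 5), (4, 7), (2, 16). Each test asks that Y and Z stay nonnegative.
  by_cases a1 : 2 ≤ q ∧ 5 * q + 50 ≤ 3 * x
  · exact step baseDecomposable_twenty_two (by omega) (by omega) (by omega) (by omega) (by omega)
      (by omega)
  by_cases a2 : 3 ≤ q ∧ x + 25 ≤ 10 * q
  · exact step baseDecomposable_five_three (by omega) (by omega) (by omega) (by omega) (by omega)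
      (by omega)
  by_cases a3 : 5 * q + 22 ≤ 3 * x ∧ x + 1 ≤ 10 * q
  · exact step baseDecomposable_nine_one (by omega) (by omega) (by omega) (by omega) (by omega)
      (by omega)
  by_cases a4 : 5 * q + 16 ≤ 3 * x ∧ x + 3 ≤ 10 * q
  · exact step baseDecomposable_seven_one (by omega) (by omega) (by omega) (by omega) (by omega)
      (by omega)
  by_cases a5 : 5 * q + 10 ≤ 3 * x ∧ x + 5 ≤ 10 * q
  · exact step baseDecomposable_five_one (by omega) (by omega) (by omega) (by omega) (by omega)
      (by omega)
  by_cases a6 : 5 * q + 4 ≤ 3 * x ∧ x + 7 ≤ 10 * q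
  · exact step baseDecomposable_three_one (by omega) (by omega) (by omega) (by omega) (by omega)
      (by omega)
  by_cases a7 : 2 ≤ q ∧ 5 * q + 2 ≤ 3 * x ∧ x + 16 ≤ 10 * q
  · exact step baseDecomposable_four_two (by omega) (by omega) (by omega) (by omega) (by omega)
      (by omega)
  -- No pair is left here. Since Y is even and Y + 3Z = 25q, the failed tests exclude q = 1, 2 by
  -- enumeration and q ≥ 3 by size, so the last call, with (7, 3) = (3, 1) + (4, 2), is vacuous.
  have hq3 : 3 ≤ q := by
    by_contra hlt
    have : x ≤ 20 := by omega
    interval_cases q <;> interval_cases x <;> omega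
  · exact step baseDecomposable_seven_three (by omega) (by omega) (by omega) (by omega) (by omega)
      (by omega)

/-! ### Lifting base cycles -/

/-- The complete tripartite graph with parts `A`, `Z × Fin 5` and `Z × Fin 5`. -/
def liftGraph (A Z : Type) : SimpleGraph (A ⊕ (Z × (Fin 5 ⊕ Fin 5))) where
  Adj
    | .inl _, .inl _ => False
    | .inl _, .inr _ => True
    | .inr _, .inl _ => True
    | .inr (_, .inl _), .inr (_, .inl _) => False
    | .inr (_, .inl _), .inr (_, .inr _) => True
    | .inr (_, .inr _), .inr (_, .inl _) => True
    | .inr (_, .inr _), .inr (_, .inr _) => False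
  symm := ⟨by rintro (_ | ⟨_, _ | _⟩) (_ | ⟨_, _ | _⟩) <;> exact id⟩
  loopless := ⟨by rintro (_ | ⟨_, _ | _⟩) <;> exact id⟩

section Lift

variable {A Z : Type} [AddCommGroup Z]

/-- The translate by `z` of the lift of a base cycle, where crossing an edge with label `d` shifts
by `d`. -/
def BaseCycle.lift (z : Z) : BaseCycle A Z → Fin 5 → A ⊕ (Z × (Fin 5 ⊕ Fin 5))
  | y a u a' b c d => ![.inl a, .inr (z, u), .inl a', .inr (z, .inl b), .inr (z + d, .inr c)]
  | BaseCycle.z a b c b' c' d₁ d₂ d₃ => ![.inl a, .inr (z, .inl b), .inr (z + d₁, .inr c),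
      .inr (z + d₁ - d₂, .inl b'), .inr (z + d₁ - d₂ + d₃, .inr c')]

/-- The level, relative to `z`, of each lifted edge: that of its end outside `A`, or of its `.inl`
end if the edge is labelled. -/
def BaseCycle.shift : BaseCycle A Z → Fin 5 → Z
  | y _ _ _ _ _ d => ![0, 0, 0, 0, d]
  | z _ _ _ _ _ d₁ d₂ d₃ => ![0, 0, d₁ - d₂, d₁ - d₂, d₁ - d₂ + d₃]

def BaseEdge.lift (z : Z) : BaseEdge A Z → Sym2 (A ⊕ (Z × (Fin 5 ⊕ Fin 5)))
  | .inl (a, u) => s(.inl a, .inr (z, u))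
  | .inr (b, c, d) => s(.inr (z, .inl b), .inr (z + d, .inr c))

theorem BaseCycle.lift_edge (C : BaseCycle A Z) (z : Z) (k : Fin 5) :
    s(C.lift z k, C.lift z (k + 1)) = BaseEdge.lift (z + C.shift k) (C.edges k) := by
  cases C <;> fin_cases k <;>
    simp [BaseCycle.lift, BaseCycle.shift, BaseEdge.lift, BaseCycle.edges, Sym2.eq_swap] <;>
    abel_nf <;> simp

theorem BaseEdge.lift_mem (e : BaseEdge A Z) (z : Z) : e.lift z ∈ (liftGraph A Z).edgeSet := by
  rcases e with ⟨a, u⟩ | ⟨b, c, d⟩ <;> trivial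

theorem BaseEdge.lift_injective {e e' : BaseEdge A Z} {z z' : Z} (h : e.lift z = e'.lift z') :
    e = e' ∧ z = z' := by
  rcases e with ⟨a, u⟩ | ⟨b, c, d⟩ <;> rcases e' with ⟨a', u'⟩ | ⟨b', c', d'⟩ <;>
    simp [BaseEdge.lift] at h ⊢
  · tauto
  · obtain ⟨⟨rfl, rfl⟩, h, rfl⟩ := h
    simpa using h

theorem BaseEdge.exists_lift_eq (e : Sym2 (A ⊕ (Z × (Fin 5 ⊕ Fin 5))))
    (he : e ∈ (liftGraph A Z).edgeSet) : ∃ (e' : BaseEdge A Z) (z : Z), e'.lift z = e := by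
  induction e using Sym2.ind with
  | _ u v =>
  rcases u with a | ⟨z, b | c⟩ <;> rcases v with a' | ⟨z', b' | c'⟩ <;> try exact he.elim
  · exact ⟨.inl (a, .inl b'), z', rfl⟩
  · exact ⟨.inl (a, .inr c'), z', rfl⟩
  · exact ⟨.inl (a', .inl b), z, Sym2.eq_swap⟩
  · exact ⟨.inr (b, c', z' - z), z, by simp [BaseEdge.lift]⟩
  · exact ⟨.inl (a', .inr c), z, Sym2.eq_swap⟩
  · exact ⟨.inr (b', c, z - z'), z', by simp [BaseEdge.lift, Sym2.eq_swap]⟩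

theorem BaseCycle.Proper.lift_injective {C : BaseCycle A Z} (h : C.Proper) (z : Z) :
    Injective (C.lift z) := by
  intro k l hkl
  cases C <;> simp only [BaseCycle.Proper] at h <;> fin_cases k <;> fin_cases l <;>
    simp [BaseCycle.lift] at hkl ⊢ <;> grind

theorem BaseDecomposable.hasFamily_liftGraph (h : BaseDecomposable A Z) :
    HasFiveCycleFamily (liftGraph A Z) := by
  obtain ⟨T, f, hf, hinj, hsurj⟩ := h
  refine ⟨T × Z, fun x => (f x.1).lift x.2, fun x => (hf _).lift_injective _, ?_, ?_⟩
  · intro x k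
    rw [← SimpleGraph.mem_edgeSet, BaseCycle.lift_edge]
    exact BaseEdge.lift_mem _ _
  · intro e he
    simp only [BaseCycle.lift_edge]
    obtain ⟨e', z, rfl⟩ := BaseEdge.exists_lift_eq e he
    obtain ⟨⟨t, k⟩, rfl⟩ := hsurj e'
    -- The only translate that puts edge `k` at level `z`.
    refine ⟨((t, z - (f t).shift k), k), by simp, ?_⟩
    rintro ⟨⟨t', z'⟩, k'⟩ h'
    obtain ⟨h1, h2⟩ := BaseEdge.lift_injective h'
    have := @hinj (t', k') (t, k) h1
    simp only [Prod.mk.injEq] at this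
    obtain ⟨rfl, rfl⟩ := this
    simp [← h2]

end Lift

/-! ### Two equal parts, and the Latin square blow-up -/

abbrev completeThreePartite (X : Fin 3 → Type) : SimpleGraph (Σ i, X i) :=
  SimpleGraph.completeMultipartiteGraph X

def completeThreePartiteIso {X Y : Fin 3 → Type} (σ : Fin 3 ≃ Fin 3)
    (e : ∀ i, X i ≃ Y (σ i)) : completeThreePartite X ≃g completeThreePartite Y where
  toEquiv := Equiv.sigmaCongr σ e
  map_rel_iff' := by
    rintro ⟨i, x⟩ ⟨j, y⟩
    exact not_congr σ.injective.eq_iff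

def liftGraphIso {A Z : Type} {X : Fin 3 → Type} (e₀ : A ≃ X 0) (e₁ : Z × Fin 5 ≃ X 1)
    (e₂ : Z × Fin 5 ≃ X 2) : liftGraph A Z ≃g completeThreePartite X where
  toFun
    | .inl a => ⟨0, e₀ a⟩
    | .inr (z, .inl b) => ⟨1, e₁ (z, b)⟩
    | .inr (z, .inr c) => ⟨2, e₂ (z, c)⟩
  invFun
    | ⟨0, a⟩ => .inl (e₀.symm a)
    | ⟨1, b⟩ => .inr ((e₁.symm b).1, .inl (e₁.symm b).2)
    | ⟨2, c⟩ => .inr ((e₂.symm c).1, .inr (e₂.symm c).2)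
  left_inv := by rintro (_ | ⟨_, _ | _⟩) <;> simp
  right_inv := by rintro ⟨i, x⟩; fin_cases i <;> simp
  map_rel_iff' := by
    rintro (_ | ⟨_, _ | _⟩) (_ | ⟨_, _ | _⟩) <;>
      simp [liftGraph]

/-- A complete tripartite graph with two parts of size `p` decomposes into 5-cycles when `5 ∣ p`
and the size of the third part has the parity of `p` and lies between `p / 3` and `2 * p`. -/
theorem hasFamily_of_two_parts_eq {p : ℕ} (hp : 0 < p) (hp5 : 5 ∣ p) (w : Fin 3 → ℕ) (i : Fin 3)
    (hw : ∀ j, j ≠ i → w j = p) (h3 : p ≤ 3 * w i) (h2 : w i ≤ 2 * p)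
    (hpar : w i % 2 = p % 2) : HasFiveCycleFamily (completeThreePartite fun j => Fin (w j)) := by
  obtain ⟨q, rfl⟩ := hp5
  have : NeZero q := ⟨by omega⟩
  have hbase := (baseDecomposable_of_le q (w i) (by omega) (by omega) (by omega)).congr
    (Equiv.refl _) (ZMod.finEquiv q).toEquiv
  have hcard : ∀ j, j ≠ i → Nonempty (ZMod q × Fin 5 ≃ Fin (w j)) := fun j hj =>
    ⟨Fintype.equivOfCardEq (by simp [hw j hj, ZMod.card, mul_comm])⟩
  let σ : Fin 3 ≃ Fin 3 := Equiv.swap 0 i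
  have h0 : σ 0 = i := Equiv.swap_apply_left _ _
  have h1 : σ 1 ≠ i := fun h => absurd (σ.injective (h.trans h0.symm)) (by decide)
  have h2' : σ 2 ≠ i := fun h => absurd (σ.injective (h.trans h0.symm)) (by decide)
  have iso : liftGraph (Fin (w i)) (ZMod q) ≃g
      completeThreePartite (fun j => Fin (w (σ j))) :=
    liftGraphIso (finCongr (by rw [h0])) (hcard _ h1).some (hcard _ h2').some
  exact (hbase.hasFamily_liftGraph.of_iso iso).of_iso
    (completeThreePartiteIso σ fun _ => Equiv.refl _)

/-- Blow-up along the cyclic Latin square of order `m`. -/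
theorem hasFamily_of_latin_square {m : ℕ} (Y : Fin 3 → ZMod m → Type)
    (h : ∀ k : Fin 3 → ZMod m, k 0 + k 1 + k 2 = 0 →
      HasFiveCycleFamily (completeThreePartite fun i => Y i (k i))) :
    HasFiveCycleFamily (completeThreePartite fun i => Σ a, Y i a) := by
  refine .of_embeddings (J := {k : Fin 3 → ZMod m // k 0 + k 1 + k 2 = 0})
    (G := fun k => completeThreePartite fun i => Y i (k.1 i))
    (fun k => ⟨fun x => ⟨x.1, k.1 x.1, x.2⟩, fun h => h⟩) ?_ (fun k => h k.1 k.2) ?_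
  · rintro k ⟨i, x⟩ ⟨j, y⟩ hxy
    obtain ⟨rfl, hxy⟩ := Sigma.mk.inj_iff.1 hxy
    simpa using hxy
  · intro e he
    induction e using Sym2.ind with
    | _ u v =>
    obtain ⟨i, a, x⟩ := u
    obtain ⟨j, b, y⟩ := v
    have hij : i ≠ j := he
    -- An edge fixes two coordinates of the triple, and the zero sum determines the third.
    have hex : ∃! k : {k : Fin 3 → ZMod m // k 0 + k 1 + k 2 = 0}, k.1 i = a ∧ k.1 j = b := by
      refine ⟨⟨fun l => if l = i then a else if l = j then b else -(a + b), ?_⟩, ?_, ?_⟩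
      · fin_cases i <;> fin_cases j <;> first | exact absurd rfl hij | (simp; try abel)
      · simp [hij.symm]
      · rintro ⟨k, hk⟩ ⟨rfl, rfl⟩
        ext l
        have : ∀ l, l ≠ i → l ≠ j → k l = -(k i + k j) := by
          intro l hi hj
          rw [eq_neg_iff_add_eq_zero, ← hk]
          fin_cases i <;> fin_cases j <;> fin_cases l <;> first | contradiction | (simp; try abel)
        by_cases hi : l = i
        · simp [hi]
        · by_cases hj : l = j
          · simp [hj, hij.symm]
          · simp [hi, hj, this l hi hj]
    obtain ⟨k, ⟨rfl, rfl⟩, hu⟩ := hex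
    refine ⟨k, ⟨s(⟨i, x⟩, ⟨j, y⟩), hij, rfl⟩, ?_⟩
    rintro k' ⟨e', -, he'⟩
    refine hu k' ?_
    induction e' using Sym2.ind with
    | _ u v =>
    rcases Sym2.eq_iff.1 he' with ⟨h1, h2⟩ | ⟨h1, h2⟩ <;>
    · obtain ⟨i', x'⟩ := u
      obtain ⟨j', y'⟩ := v
      obtain ⟨rfl, h1⟩ := Sigma.mk.inj_iff.1 h1
      obtain ⟨rfl, h2⟩ := Sigma.mk.inj_iff.1 h2
      have e1 := (Sigma.mk.inj_iff.1 (eq_of_heq h1)).1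
      have e2 := (Sigma.mk.inj_iff.1 (eq_of_heq h2)).1
      exact ⟨by assumption, by assumption⟩

def neighborSetEquiv (w : Fin 3 → ℕ) (i : Fin 3) (x : Fin (w i)) :
    (completeThreePartite fun j => Fin (w j)).neighborSet ⟨i, x⟩ ≃
      Σ j : {j : Fin 3 // i ≠ j}, Fin (w j) where
  toFun u := ⟨⟨u.1.1, u.2⟩, u.1.2⟩
  invFun u := ⟨⟨u.1.1, u.2⟩, u.1.2⟩

theorem HasFiveCycleFamily.even_sum_parts {w : Fin 3 → ℕ}
    (h : HasFiveCycleFamily (completeThreePartite fun j => Fin (w j))) (i : Fin 3)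
    (hi : 0 < w i) : Even (∑ j : {j : Fin 3 // i ≠ j}, w j) := by
  have := Finite.of_equiv _ (neighborSetEquiv w i ⟨0, hi⟩).symm
  have h := h.even_card_neighborSet ⟨i, ⟨0, hi⟩⟩
  rw [Nat.card_congr (neighborSetEquiv w i ⟨0, hi⟩), Nat.card_sigma] at h
  simp only [Nat.card_fin] at h
  convert h

/-! ### Assembling the blow-up -/

theorem hasFamily_add_mul {w : Fin 3 → ℕ} {p : ℕ} (hp : 0 < p) (hp5 : 5 ∣ p)
    (hdec : HasFiveCycleFamily (completeThreePartite fun j => Fin (w j)))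
    (h3 : ∀ i, p ≤ 3 * w i) (h2 : ∀ i, w i ≤ 2 * p) (hpar : ∀ i, w i % 2 = p % 2) (n : ℕ) :
    HasFiveCycleFamily (completeThreePartite fun j => Fin (w j + n * p)) := by
  let sz : Fin 3 → ZMod (n + 1) → ℕ := fun i a => if a = 0 then w i else p
  have key : ∀ k : Fin 3 → ZMod (n + 1), k 0 + k 1 + k 2 = 0 →
      HasFiveCycleFamily (completeThreePartite fun i => Fin (sz i (k i))) := by
    intro k hk
    by_cases h0 : ∀ i, k i = 0
    · have : (fun i => Fin (sz i (k i))) = fun i => Fin (w i) := by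
        funext i
        rw [h0 i]
        exact congrArg Fin (if_pos rfl)
      rwa [this]
    -- A nonzero triple with sum zero has at most one zero entry.
    · have hi : ∃ i, ∀ j, j ≠ i → k j ≠ 0 := by
        by_cases z0 : k 0 = 0
        · refine ⟨0, fun j hj hkj => h0 ?_⟩
          intro l
          fin_cases j <;> fin_cases l <;> simp_all
        by_cases z1 : k 1 = 0
        · refine ⟨1, fun j hj hkj => h0 ?_⟩
          intro l
          fin_cases j <;> fin_cases l <;> simp_all
        · refine ⟨2, fun j hj hkj => ?_⟩
          fin_cases j <;> simp_all
      obtain ⟨i, hi⟩ := hi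
      refine hasFamily_of_two_parts_eq hp hp5 _ i (fun j hj => by simp [sz, hi j hj]) ?_ ?_ ?_ <;>
      · simp only [sz]
        split_ifs
        · first | exact h3 i | exact h2 i | exact hpar i
        · omega
  have hcard : ∀ i, Nonempty ((Σ a, Fin (sz i a)) ≃ Fin (w i + n * p)) := fun i =>
    ⟨Fintype.equivOfCardEq (by
      simp only [Fintype.card_sigma, Fintype.card_fin, sz]
      rw [← Finset.add_sum_erase _ _ (Finset.mem_univ (0 : ZMod (n + 1))), if_pos rfl,
        Finset.sum_congr rfl fun a ha => if_neg (Finset.ne_of_mem_erase ha)]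
      simp [ZMod.card])⟩
  exact (hasFamily_of_latin_square (fun i a => Fin (sz i a)) key).of_iso
    (completeThreePartiteIso (Equiv.refl _) fun i => (hcard i).some)

theorem mainTheorem6 (r s t p : ℕ) (hrs : r ≤ s) (hst : s ≤ t)
    (hdec : FiveCycleDecomposable (completeTripartite r s t))
    (hp5 : 5 ∣ p) (hpr : p ≡ r [MOD 2])
    (htp : (t : ℚ) / 2 ≤ (p : ℚ)) (hp3 : p ≤ 3 * r) :
    FiveCycleDecomposable (completeTripartite (r + 2 * p) (s + 2 * p) (t + 2 * p)) ∧
      ∀ n : ℕ, FiveCycleDecomposable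
        (completeTripartite (r + n * p) (s + n * p) (t + n * p)) := by
  suffices h : ∀ n : ℕ, FiveCycleDecomposable
      (completeTripartite (r + n * p) (s + n * p) (t + n * p)) from ⟨h 2, h⟩
  intro n
  have htp' : t ≤ 2 * p := by
    rw [div_le_iff₀ two_pos] at htp
    have : t ≤ p * 2 := by exact_mod_cast htp
    omega
  rcases Nat.eq_zero_or_pos p with rfl | hp
  · simpa using hdec
  have hfam : HasFiveCycleFamily (completeThreePartite fun j => Fin (![r, s, t] j)) :=
    hdec.hasFamily
  have hpr' : p % 2 = r % 2 := hpr
  -- Since 0 < p ≤ 3r, all parts are nonempty. The even degrees r + s and r + t then give s and t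
  -- the parity of p.
  have sum2 := hfam.even_sum_parts 2 (by simp; omega)
  have sum1 := hfam.even_sum_parts 1 (by simp; omega)
  have e2 : Even (r + s) := by
    have : (∑ j : {j : Fin 3 // 2 ≠ j}, ![r, s, t] j) = r + s := by
      rw [← Finset.sum_subtype {0, 1} (by decide) ![r, s, t]]
      simp
    rwa [this] at sum2
  have e1 : Even (r + t) := by
    have : (∑ j : {j : Fin 3 // 1 ≠ j}, ![r, s, t] j) = r + t := by
      rw [← Finset.sum_subtype {0, 2} (by decide) ![r, s, t]]
      simp
    rwa [this] at sum1
  rw [Nat.even_iff] at e1 e2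
  have := hasFamily_add_mul hp hp5 hfam
    (by intro i; fin_cases i <;> simp <;> omega) (by intro i; fin_cases i <;> simp <;> omega)
    (by intro i; fin_cases i <;> simp <;> omega) n
  refine (this.of_iso (completeThreePartiteIso (Equiv.refl _) fun i => finCongr ?_)).decomposable
  fin_cases i <;> rfl
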